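/- Let $\mathcal C$ be a model category with all small limits. A functorial simplicial framing on $\mathcal C$ is a functor $y\mapsto y^{\Delta^\bullet}$ from $\mathcal C$ to simplicial objects of $\mathcal C$ together with a natural map $y\to y^{\Delta^\bullet}$ ($y$ being viewed as a constant simplicial object), such that $y\to y^{\Delta^0}$ is an isomorphism for every $y$, and such that for every fibrant $y$: each $y\to y^{\Delta^n}$ is a weak equivalence, and for every monomorphism $S\to T$ of simplicial sets the induced map $y^T\to y^S$ is a fibration, where $y^S=\lim_{\Delta^n\to S}y^{\Delta^n}$. Let such a framing be given, together with a composition law making the fibrant cofibrant objects of $\mathcal C$ into a simplicial category: maps of simplicial sets $$\mathrm{Map}(x,y)\times\mathrm{Map}(y,z)\to\mathrm{Map}(x,z),\qquad \mathrm{Map}(x,y)_n=\mathrm{Hom}_{\mathcal C}(x,y^{\Delta^n}),$$ for fibrant cofibrant $x,y,z$, which are associative, have the structure maps $x\to x^{\Delta^n}$ as identities, and are in degree $0$ the composition of $\mathcal C$ (through $y\cong y^{\Delta^0}$). The weak equivalences $x\to y^{\Delta^n}$ are closed under this composition and under the simplicial operators, so there is a simplicial category $W_*(\mathcal C)$ whose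 objects are the fibrant cofibrant objects of $\mathcal C$ and whose $n$-maps $x\to y$ are the weak equivalences $x\to y^{\Delta^n}$. Then $W_*(\mathcal C)$ is a fibrant groupoid, that is: 1. $W_*(\mathcal C)$ is a fibrant simplicial category: the functor from $W_*(\mathcal C)$ to the terminal simplicial category is a fibration in the standard model structure on simplicial categories. (A simplicial functor $f:\mathcal A\to\mathcal B$ is such a fibration if all maps $\mathrm{Map}_{\mathcal A}(x,y)\to\mathrm{Map}_{\mathcal B}(fx,fy)$ are Kan fibrations and, for all $x\in\mathcal A$, every homotopy equivalence $fx\to z$ in $\mathcal B$ lifts to a homotopy equivalence $x\to y$ in $\mathcal A$; a $0$-map is a homotopy equivalence if its class in $\pi_0$ is an isomorphism.) In particular, the simplicial sets of maps of $W_*(\mathcal C)$ are Kan complexes. 2. The category $\pi_0(W_*(\mathcal C))$, which has the same objects and has the connected components of the simplicial sets of maps as morphisms, is a groupoid. -/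

import Mathlib

open CategoryTheory Opposite Limits MonoidalCategory HomotopicalAlgebra Simplicial

universe u v w

noncomputable section

/-! ### Simplicial categories: the category of components, weak fibrations, fibrant groupoids -/

namespace SimpCat

/-- The category `π₀(W)` of a simplicially enriched category `W`: it has the same objects, and
its morphisms `x ⟶ y` are the connected components of the simplicial set of maps. -/
structure PiZero (W : Type u) where
  /-- the object of `W` -/
  obj : W

section

variable {W : Type u} [EnrichedCategory SSet.{v} W]

/-- The `0`-simplex of `Hom(x, x)` given by the identity. -/
def id₀ (x : W) : (x ⟶[SSet.{v}] x) _⦋0⦌ :=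
  (eId SSet.{v} x).app (op ⦋0⦌) PUnit.unit

/-- The composition of `n`-simplices of the simplicial sets of maps. -/
def compAt {x y z : W} {n : SimplexCategoryᵒᵖ} (f : (x ⟶[SSet.{v}] y).obj n)
    (g : (y ⟶[SSet.{v}] z).obj n) : (x ⟶[SSet.{v}] z).obj n :=
  (eComp SSet.{v} x y z).app n (f, g)

/-- Naturality of a map out of a product of simplicial sets. -/
lemma pairing_map {X Y Z : SSet.{v}} (φ : X ⊗ Y ⟶ Z) {n m : SimplexCategoryᵒᵖ} (α : n ⟶ m)
    (a : X.obj n) (b : Y.obj n) :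
    Z.map α (φ.app n (a, b)) = φ.app m (X.map α a, Y.map α b) := by
  let p : (X ⊗ Y).obj n := (a, b)
  exact (NatTrans.naturality_apply φ α p).symm

lemma compAt_map {x y z : W} {n m : SimplexCategoryᵒᵖ} (α : n ⟶ m)
    (f : (x ⟶[SSet.{v}] y).obj n) (g : (y ⟶[SSet.{v}] z).obj n) :
    (x ⟶[SSet.{v}] z).map α (compAt f g) =
      compAt ((x ⟶[SSet.{v}] y).map α f) ((y ⟶[SSet.{v}] z).map α g) :=
  pairing_map (eComp SSet.{v} x y z) α f g

lemma id₀_compAt {x y : W} (f : (x ⟶[SSet.{v}] y) _⦋0⦌) : compAt (id₀ x) f = f :=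
  ConcreteCategory.congr_hom (NatTrans.congr_app (e_id_comp SSet.{v} x y) (op ⦋0⦌)) f

lemma compAt_id₀ {x y : W} (f : (x ⟶[SSet.{v}] y) _⦋0⦌) : compAt f (id₀ y) = f :=
  ConcreteCategory.congr_hom (NatTrans.congr_app (e_comp_id SSet.{v} x y) (op ⦋0⦌)) f

lemma compAt_assoc {x y z t : W} {n : SimplexCategoryᵒᵖ} (f : (x ⟶[SSet.{v}] y).obj n)
    (g : (y ⟶[SSet.{v}] z).obj n) (h : (z ⟶[SSet.{v}] t).obj n) :
    compAt (compAt f g) h = compAt f (compAt g h) := by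
  let p : ((x ⟶[SSet.{v}] y) ⊗ (y ⟶[SSet.{v}] z) ⊗ (z ⟶[SSet.{v}] t)).obj n := (f, (g, h))
  exact ConcreteCategory.congr_hom (NatTrans.congr_app (e_assoc SSet.{v} x y z t) n) p

/-- The composition of edges is an edge between the composites. -/
def compEdge {x y z : W} {f f' : (x ⟶[SSet.{v}] y) _⦋0⦌} {g g' : (y ⟶[SSet.{v}] z) _⦋0⦌}
    (a : SSet.Edge f f') (b : SSet.Edge g g') : SSet.Edge (compAt f g) (compAt f' g') :=
  SSet.Edge.mk (compAt a.edge b.edge)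
    ((compAt_map _ _ _).trans (congrArg₂ compAt a.src_eq b.src_eq))
    ((compAt_map _ _ _).trans (congrArg₂ compAt a.tgt_eq b.tgt_eq))

/-- The composition on connected components. -/
def compπ₀ {x y z : W} (f : SSet.π₀ (x ⟶[SSet.{v}] y)) (g : SSet.π₀ (y ⟶[SSet.{v}] z)) :
    SSet.π₀ (x ⟶[SSet.{v}] z) :=
  SSet.π₀.lift
    (fun a => SSet.π₀.lift (fun b => SSet.π₀.mk (compAt a b))
      (fun b _ e => SSet.π₀.sound (compEdge (SSet.Edge.id a) e)) g)
    (fun _ _ e => by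
      induction g with
      | mk b => exact SSet.π₀.sound (compEdge e (SSet.Edge.id b))) f

instance : Category.{v} (PiZero W) where
  Hom x y := SSet.π₀ (x.obj ⟶[SSet.{v}] y.obj)
  id x := SSet.π₀.mk (id₀ x.obj)
  comp f g := compπ₀ f g
  id_comp f := by
    induction f with
    | mk a => exact congrArg SSet.π₀.mk (id₀_compAt a)
  comp_id f := by
    induction f with
    | mk a => exact congrArg SSet.π₀.mk (compAt_id₀ a)
  assoc f g h := by
    induction f with
    | mk a =>
      induction g with
      | mk b =>
        induction h with
        | mk c => exact congrArg SSet.π₀.mk (compAt_assoc a b c)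

/-- The morphism of `π₀(W)` represented by a `0`-map. -/
def PiZero.homMk {x y : W} (f : (x ⟶[SSet.{v}] y) _⦋0⦌) :
    (PiZero.mk x : PiZero W) ⟶ PiZero.mk y :=
  SSet.π₀.mk f

/-- A `0`-map is a homotopy equivalence if it becomes an isomorphism in `π₀(W)`. -/
def IsHomotopyEquivalence {x y : W} (f : (x ⟶[SSet.{v}] y) _⦋0⦌) : Prop :=
  IsIso (PiZero.homMk f)

end

open scoped SSet.modelCategoryQuillen in
/-- Fibrations in the standard (Dwyer-Hirschhorn-Kan-Bergner) model structure on simplicial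
categories: local Kan fibrations along which homotopy equivalences can be lifted. -/
def IsWeakFibration {W : Type u} [EnrichedCategory SSet.{v} W] {D : Type w}
    [EnrichedCategory SSet.{v} D] (f : EnrichedFunctor SSet.{v} W D) : Prop :=
  (∀ x y : W, Fibration (f.map x y)) ∧
  ∀ (x : W) (z : D) (α : (f.obj x ⟶[SSet.{v}] z) _⦋0⦌), IsHomotopyEquivalence α →
    ∃ (y : W) (β : (x ⟶[SSet.{v}] y) _⦋0⦌), IsHomotopyEquivalence β ∧
      (⟨f.obj y, (f.map x y).app (op ⦋0⦌) β⟩ : Σ z' : D, (f.obj x ⟶[SSet.{v}] z') _⦋0⦌) = ⟨z, α⟩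

/-- The terminal simplicial category: one object, and a point as simplicial set of maps. -/
structure Point : Type where

instance : EnrichedCategory SSet.{v} Point where
  Hom _ _ := 𝟙_ SSet.{v}
  id _ := 𝟙 _
  comp _ _ _ := (λ_ (𝟙_ SSet.{v})).hom
  id_comp _ _ := rfl
  comp_id _ _ := rfl
  assoc _ _ _ _ := rfl

/-- The functor to the terminal simplicial category. -/
def toPoint (W : Type u) [EnrichedCategory SSet.{v} W] : EnrichedFunctor SSet.{v} W Point where
  obj _ := ⟨⟩
  map _ _ := CartesianMonoidalCategory.toUnit _
  map_id _ := rfl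
  map_comp _ _ _ := rfl

/-- A fibrant groupoid: a fibrant simplicial category `W` such that `π₀(W)` is a groupoid. -/
structure IsFibrantGroupoid (W : Type u) [EnrichedCategory SSet.{v} W] : Prop where
  /-- `W` is fibrant -/
  fibrant : IsWeakFibration (toPoint W)
  /-- `W` is a weak groupoid -/
  isGroupoid : IsGroupoid (PiZero W)

end SimpCat

/-! ### Functorial simplicial framings -/

namespace Framing

section

variable {C : Type u} [Category.{v} C] [HasLimits C]

instance hasLimitsOfShape_elements (S : SSet.{v}) : HasLimitsOfShape S.Elements C :=
  have : HasLimitsOfSize.{0, v} C := hasLimitsOfSizeShrink.{0, v, v, v} C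
  inferInstance

/-- The diagram of the `Y_n` indexed by the category of all simplices `Δ[n] ⟶ S`. -/
abbrev powerDiagram (Y : SimplicialObject C) (S : SSet.{v}) : S.Elements ⥤ C :=
  CategoryOfElements.π S ⋙ Y

/-- The function object `Y^S`, the limit of the `Y_n` over all simplices `Δ[n] ⟶ S`. -/
def power (Y : SimplicialObject C) (S : SSet.{v}) : C :=
  limit (powerDiagram Y S)

/-- The map `Y^T ⟶ Y^S` given by `S ⟶ T`. -/
def powerMap (Y : SimplicialObject C) {S T : SSet.{v}} (i : S ⟶ T) : power Y T ⟶ power Y S :=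
  limit.pre (powerDiagram Y T) (CategoryOfElements.map i)

end

end Framing

/-- A functorial simplicial framing in a model category `C`: a functorial map from `x`, as a
constant simplicial object, to a simplicial object `n ↦ x^{Δ[n]}`. -/
structure FunctorialSimplicialFraming (C : Type u) [Category.{v} C] [ModelCategory C]
    [HasLimits C] where
  /-- the functor sending `x` to the simplicial object `n ↦ x^{Δ[n]}` -/
  functor : C ⥤ SimplicialObject C
  /-- the functorial map from `x` to `n ↦ x^{Δ[n]}` -/
  unit : SimplicialObject.const C ⟶ functor
  isIso_unit_zero (x : C) : IsIso ((unit.app x).app (op ⦋0⦌))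
  weakEquivalence_unit (x : C) [IsFibrant x] (n : SimplexCategoryᵒᵖ) :
    WeakEquivalence ((unit.app x).app n)
  fibration_powerMap (x : C) [IsFibrant x] {S T : SSet.{v}} (i : S ⟶ T) [Mono i] :
    Fibration (Framing.powerMap (functor.obj x) i)

namespace FunctorialSimplicialFraming

variable {C : Type u} [Category.{v} C] [ModelCategory C] [HasLimits C]

section

variable (F : FunctorialSimplicialFraming C)

/-- The object `x^{Δ[n]}`. -/
abbrev pow (x : C) (n : SimplexCategoryᵒᵖ) : C := (F.functor.obj x).obj n

/-- The structure map `x ⟶ x^{Δ[n]}`. -/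
abbrev const (x : C) (n : SimplexCategoryᵒᵖ) : x ⟶ F.pow x n := (F.unit.app x).app n

/-- The simplicial set whose `n`-simplices are the maps `x ⟶ y^{Δ[n]}`. -/
def mapComplex (x y : C) : SSet.{v} := F.functor.obj y ⋙ coyoneda.obj (op x)

/-- A map `x ⟶ y^{Δ[n]}` as an `n`-simplex. -/
def simplex {x y : C} {n : SimplexCategoryᵒᵖ} (f : x ⟶ F.pow y n) : (F.mapComplex x y).obj n := f

/-- The map `x ⟶ y^{Δ[n]}` that an `n`-simplex is. -/
def toHom {x y : C} {n : SimplexCategoryᵒᵖ} (f : (F.mapComplex x y).obj n) : x ⟶ F.pow y n := f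

@[simp]
lemma toHom_simplex {x y : C} {n : SimplexCategoryᵒᵖ} (f : x ⟶ F.pow y n) :
    F.toHom (F.simplex f) = f := rfl

lemma toHom_map {x y : C} {n m : SimplexCategoryᵒᵖ} (α : n ⟶ m) (f : (F.mapComplex x y).obj n) :
    F.toHom ((F.mapComplex x y).map α f) = F.toHom f ≫ (F.functor.obj y).map α := rfl

lemma const_map (x : C) {n m : SimplexCategoryᵒᵖ} (α : n ⟶ m) :
    F.const x n ≫ (F.functor.obj x).map α = F.const x m :=
  ((F.unit.app x).naturality α).symm.trans (Category.id_comp _)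

lemma weakEquivalence_map (x : C) [IsFibrant x] {n m : SimplexCategoryᵒᵖ} (α : n ⟶ m) :
    WeakEquivalence ((F.functor.obj x).map α) := by
  have := F.weakEquivalence_unit x n
  have h : WeakEquivalence (F.const x n ≫ (F.functor.obj x).map α) := by
    rw [const_map]
    exact F.weakEquivalence_unit x m
  exact weakEquivalence_of_precomp (F.const x n) _

lemma weakEquivalence_toHom_map_iff {x y : C} [IsFibrant y] {n m : SimplexCategoryᵒᵖ}
    (α : n ⟶ m) (f : (F.mapComplex x y).obj n) :
    WeakEquivalence (F.toHom ((F.mapComplex x y).map α f)) ↔ WeakEquivalence (F.toHom f) := by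
  have := F.weakEquivalence_map y α
  rw [toHom_map]
  exact weakEquivalence_postcomp_iff _ _

/-- A composition law for the simplicial sets `n ↦ Hom(x, y^{Δ[n]})`, which makes the
fibrant cofibrant objects of `C` into a simplicial category: composition of `n`-maps is
associative, the structure maps `x ⟶ x^{Δ[n]}` are the identities, and the composition of `0`-maps
is that of `C` (through the isomorphism of `y` with `y^{Δ[0]}`). -/
structure Composition where
  /-- the composition map of simplicial sets -/
  comp (x y z : BifibrantObject C) :
    F.mapComplex x.obj y.obj ⊗ F.mapComplex y.obj z.obj ⟶ F.mapComplex x.obj z.obj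
  const_comp (x y : BifibrantObject C) (n : SimplexCategoryᵒᵖ)
    (f : (F.mapComplex x.obj y.obj).obj n) :
    (comp x x y).app n (F.simplex (F.const x.obj n), f) = f
  comp_const (x y : BifibrantObject C) (n : SimplexCategoryᵒᵖ)
    (f : (F.mapComplex x.obj y.obj).obj n) :
    (comp x y y).app n (f, F.simplex (F.const y.obj n)) = f
  assoc (x y z t : BifibrantObject C) (n : SimplexCategoryᵒᵖ)
    (f : (F.mapComplex x.obj y.obj).obj n) (g : (F.mapComplex y.obj z.obj).obj n)
    (h : (F.mapComplex z.obj t.obj).obj n) :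
    (comp x z t).app n ((comp x y z).app n (f, g), h) =
      (comp x y t).app n (f, (comp y z t).app n (g, h))
  comp_zero (x y z : BifibrantObject C) (f : x.obj ⟶ y.obj) (g : y.obj ⟶ z.obj) :
    (comp x y z).app (op ⦋0⦌)
        (F.simplex (f ≫ F.const y.obj (op ⦋0⦌)), F.simplex (g ≫ F.const z.obj (op ⦋0⦌))) =
      F.simplex ((f ≫ g) ≫ F.const z.obj (op ⦋0⦌))

/-- The simplicial set whose `n`-simplices are the weak equivalences `x ⟶ y^{Δ[n]}`. -/
def weqComplex (x y : BifibrantObject C) : (F.mapComplex x.obj y.obj).Subcomplex where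
  obj n := {f | WeakEquivalence (F.toHom f)}
  map {_ _} α f hf := by
    have : IsFibrant y.obj := y.property.2
    exact (F.weakEquivalence_toHom_map_iff α f).2 hf

end

variable {F : FunctorialSimplicialFraming C}

lemma Composition.weakEquivalence_comp_zero (κ : F.Composition) {x y z : BifibrantObject C}
    (f : (F.mapComplex x.obj y.obj) _⦋0⦌) (g : (F.mapComplex y.obj z.obj) _⦋0⦌)
    (hf : WeakEquivalence (F.toHom f)) (hg : WeakEquivalence (F.toHom g)) :
    WeakEquivalence (F.toHom ((κ.comp x y z).app (op ⦋0⦌) (f, g))) := by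
  have := F.isIso_unit_zero y.obj
  have := F.isIso_unit_zero z.obj
  have ef : f = F.simplex ((F.toHom f ≫ inv (F.const y.obj (op ⦋0⦌))) ≫ F.const _ _) := by
    rw [Category.assoc, IsIso.inv_hom_id, Category.comp_id]
    rfl
  have eg : g = F.simplex ((F.toHom g ≫ inv (F.const z.obj (op ⦋0⦌))) ≫ F.const _ _) := by
    rw [Category.assoc, IsIso.inv_hom_id, Category.comp_id]
    rfl
  have h := κ.comp_zero x y z (F.toHom f ≫ inv (F.const y.obj (op ⦋0⦌)))
    (F.toHom g ≫ inv (F.const z.obj (op ⦋0⦌)))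
  rw [← ef, ← eg] at h
  rw [h, toHom_simplex]
  infer_instance

lemma Composition.weakEquivalence_comp (κ : F.Composition) {x y z : BifibrantObject C}
    {n : SimplexCategoryᵒᵖ}
    (f : (F.mapComplex x.obj y.obj).obj n) (g : (F.mapComplex y.obj z.obj).obj n)
    (hf : WeakEquivalence (F.toHom f)) (hg : WeakEquivalence (F.toHom g)) :
    WeakEquivalence (F.toHom ((κ.comp x y z).app n (f, g))) := by
  have : IsFibrant y.obj := y.property.2
  have : IsFibrant z.obj := z.property.2
  let α : n ⟶ op ⦋0⦌ := (SimplexCategory.const ⦋0⦌ n.unop 0).op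
  rw [← F.weakEquivalence_toHom_map_iff α]
  have e := SimpCat.pairing_map (κ.comp x y z) α f g
  refine (congrArg (fun h => WeakEquivalence (F.toHom h)) e).mpr ?_
  exact κ.weakEquivalence_comp_zero _ _ ((F.weakEquivalence_toHom_map_iff α f).2 hf)
    ((F.weakEquivalence_toHom_map_iff α g).2 hg)

/-- The objects of the simplicial category `W_*(C)`: the fibrant cofibrant objects of `C`. -/
structure WStar (κ : F.Composition) where
  /-- the fibrant cofibrant object -/
  obj : BifibrantObject C

/-- The simplicial category `W_*(C)`: its `n`-maps are the weak equivalences `x ⟶ y^{Δ[n]}`,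
composed by the given composition law. -/
instance (κ : F.Composition) : EnrichedCategory SSet.{v} (WStar κ) where
  Hom x y := (F.weqComplex x.obj y.obj).toSSet
  id x :=
    { app := fun n => ↾fun _ => ⟨F.simplex (F.const x.obj.obj n), by
        have : IsFibrant x.obj.obj := x.obj.property.2
        exact F.weakEquivalence_unit x.obj.obj n⟩
      naturality := fun _ _ α => by
        ext
        exact Subtype.ext (F.const_map x.obj.obj α).symm }
  comp x y z :=
    { app := fun n => ↾fun p => ⟨(κ.comp x.obj y.obj z.obj).app n (p.1.1, p.2.1),
        κ.weakEquivalence_comp p.1.1 p.2.1 p.1.2 p.2.2⟩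
      naturality := fun _ _ α => by
        ext p
        exact Subtype.ext
          (SimpCat.pairing_map (κ.comp x.obj y.obj z.obj) α p.1.1 p.2.1).symm }
  id_comp x y := by
    ext n p
    exact Subtype.ext (κ.const_comp x.obj y.obj n p.1)
  comp_id x y := by
    ext n p
    exact Subtype.ext (κ.comp_const x.obj y.obj n p.1)
  assoc x y z t := by
    ext n p
    exact Subtype.ext (κ.assoc x.obj y.obj z.obj t.obj n p.1.1 p.2.1.1 p.2.2.1)

end FunctorialSimplicialFraming

end

/-! By the universal property of limits, maps `x ⟶ y^S` are the same as simplicial maps `S ⟶ Map(x,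
y)`. Filling a horn in `Map(x, y)` thus means lifting a map from the cofibrant `x` through
`y^{Δ[n+1]} ⟶ y^Λ`. This is a fibration by the framing axiom. It is a weak equivalence because `y ⟶
y^Λ` is one: a horn is a union of faces through one vertex, and `S ↦ y^S` turns unions into
pullbacks along fibrations (`weakEquivalence_constPower_sup`). The filler stays among weak
equivalences, since simplicial operators preserve and reflect them. So the mapping complexes of
`W_*(C)` are Kan; lifting homotopy equivalences over a point is trivial.

For `π₀`, every vertex comes from a weak equivalence of `C`, which has a homotopy inverse by
Whitehead's theorem, and a left homotopy in `C` gives an edge (`exists_edge_of_leftHomotopyRel`). -/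

namespace Framing

/-! ### Function objects `Y^S` and their universal property -/

section

variable {C : Type u} [Category.{v} C] [HasLimits C]

/-- The evaluation `Y^S ⟶ Y_n` at an `n`-simplex of `S`. -/
noncomputable def powerEval (Y : SimplicialObject C) {S : SSet.{v}} {n : SimplexCategoryᵒᵖ} (s : S.obj n) :
    power Y S ⟶ Y.obj n :=
  limit.π (powerDiagram Y S) (S.elementsMk n s)

lemma powerEval_map (Y : SimplicialObject C) {S : SSet.{v}} {n m : SimplexCategoryᵒᵖ}
    (α : n ⟶ m) (s : S.obj n) :
    powerEval Y s ≫ Y.map α = powerEval Y (S.map α s) :=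
  limit.w (powerDiagram Y S)
    (CategoryOfElements.homMk (S.elementsMk n s) (S.elementsMk m (S.map α s)) α rfl)

lemma powerMap_eval (Y : SimplicialObject C) {S T : SSet.{v}} (i : S ⟶ T)
    {n : SimplexCategoryᵒᵖ} (s : S.obj n) :
    powerMap Y i ≫ powerEval Y s = powerEval Y (i.app n s) :=
  limit.pre_π (powerDiagram Y T) (CategoryOfElements.map i) (S.elementsMk n s)

lemma powerEval_of_powerMap_eq {Y : SimplicialObject C} {S T : SSet.{v}} {i : S ⟶ T} {x : C}
    {f : x ⟶ power Y T} {g : x ⟶ power Y S} (h : f ≫ powerMap Y i = g)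
    {n : SimplexCategoryᵒᵖ} (s : S.obj n) :
    f ≫ powerEval Y (i.app n s) = g ≫ powerEval Y s := by
  rw [← h, Category.assoc, powerMap_eval]

lemma power_hom_ext {Y : SimplicialObject C} {S : SSet.{v}} {x : C} {f g : x ⟶ power Y S}
    (h : ∀ (n : SimplexCategoryᵒᵖ) (s : S.obj n), f ≫ powerEval Y s = g ≫ powerEval Y s) :
    f = g :=
  limit.hom_ext fun e => h e.1 e.2

lemma powerMap_comp (Y : SimplicialObject C) {R S T : SSet.{v}} (i : R ⟶ S) (j : S ⟶ T) :
    powerMap Y j ≫ powerMap Y i = powerMap Y (i ≫ j) := by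
  refine power_hom_ext fun n s => ?_
  rw [Category.assoc, powerMap_eval, powerMap_eval, powerMap_eval]
  rfl

/-- The morphism `x ⟶ Y^S` given by a map from `S` to the simplicial set `Hom(x, Y_•)`. -/
noncomputable def powerLift {Y : SimplicialObject C} {S : SSet.{v}} {x : C}
    (φ : S ⟶ Y ⋙ coyoneda.obj (op x)) : x ⟶ power Y S :=
  limit.lift (powerDiagram Y S)
    { pt := x
      π :=
        { app := fun e => φ.app e.1 e.2
          naturality := fun e e' α =>
            (Category.id_comp _).trans ((congrArg (φ.app e'.1) α.2).symm.trans
              (NatTrans.naturality_apply φ α.1 e.2)) } }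

lemma powerLift_eval {Y : SimplicialObject C} {S : SSet.{v}} {x : C}
    (φ : S ⟶ Y ⋙ coyoneda.obj (op x)) {n : SimplexCategoryᵒᵖ} (s : S.obj n) :
    powerLift φ ≫ powerEval Y s = φ.app n s :=
  limit.lift_π _ (S.elementsMk n s)

/-- The map from `S` to the simplicial set `Hom(x, Y_•)` given by a morphism `x ⟶ Y^S`. -/
noncomputable def ofPower {Y : SimplicialObject C} {S : SSet.{v}} {x : C} (f : x ⟶ power Y S) :
    S ⟶ Y ⋙ coyoneda.obj (op x) where
  app n := ↾fun s => f ≫ powerEval Y s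
  naturality n m α := by
    ext s
    refine Eq.trans ?_ (Category.assoc f (powerEval Y s) (Y.map α)).symm
    exact congrArg (f ≫ ·) (powerEval_map Y α s).symm

/-- A cone over the cospan is a pair of simplicial maps out of `S` and `T` agreeing on `R`, hence
one map out of the pushout `U`. -/
lemma powerMap_isPullback (Y : SimplicialObject C) {R S T U : SSet.{v}} {i : R ⟶ S} {j : R ⟶ T}
    {k : S ⟶ U} {l : T ⟶ U} (h : IsPushout i j k l) :
    IsPullback (powerMap Y k) (powerMap Y l) (powerMap Y i) (powerMap Y j) where
  w := by rw [powerMap_comp, powerMap_comp, h.w]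
  isLimit' := by
    have w (s : PullbackCone (powerMap Y i) (powerMap Y j)) :
        i ≫ ofPower s.fst = j ≫ ofPower s.snd := by
      ext n r
      have e := s.condition =≫ powerEval Y r
      rw [Category.assoc, Category.assoc, powerMap_eval, powerMap_eval] at e
      exact e
    refine ⟨PullbackCone.IsLimit.mk _ (fun s => powerLift (h.desc _ _ (w s))) ?_ ?_ ?_⟩
    · intro s
      refine power_hom_ext fun n t => ?_
      rw [Category.assoc, powerMap_eval, powerLift_eval]
      exact ConcreteCategory.congr_hom (NatTrans.congr_app (h.inl_desc _ _ (w s)) n) t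
    · intro s
      refine power_hom_ext fun n t => ?_
      rw [Category.assoc, powerMap_eval, powerLift_eval]
      exact ConcreteCategory.congr_hom (NatTrans.congr_app (h.inr_desc _ _ (w s)) n) t
    · intro s m hk hl
      have e : ofPower m = h.desc _ _ (w s) := by
        refine h.hom_ext ?_ ?_
        · rw [h.inl_desc, ← hk]
          ext n t
          exact (congrArg (m ≫ ·) (powerMap_eval Y k t).symm).trans (Category.assoc _ _ _).symm
        · rw [h.inr_desc, ← hl]
          ext n t
          exact (congrArg (m ≫ ·) (powerMap_eval Y l t).symm).trans (Category.assoc _ _ _).symm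
      refine power_hom_ext fun n t => ?_
      rw [powerLift_eval, ← e]
      rfl

/-- The universal element is initial in the category of elements, so the limit is the value there.
-/
lemma isIso_powerEval (Y : SimplicialObject C) {S : SSet.{v}} {a : SimplexCategory}
    (h : S.RepresentableBy a) : IsIso (powerEval Y (h.homEquiv (𝟙 a))) :=
  isIso_π_of_isInitial (Functor.Elements.isInitialOfRepresentableBy h) (powerDiagram Y S)

end

end Framing

/-! ### The maps `y ⟶ y^S` for faces and horns -/

namespace FunctorialSimplicialFraming

open Framing

variable {C : Type u} [Category.{v} C] [ModelCategory C] [HasLimits C]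

section

variable (F : FunctorialSimplicialFraming C)

/-- The map from `S` to `Map(x, x)` which is constant at the identity. -/
def constMap (x : C) (S : SSet.{v}) : S ⟶ F.mapComplex x x where
  app n := ↾fun _ => F.const x n
  naturality _ _ α := by
    ext
    exact (F.const_map x α).symm

/-- The structure map `x ⟶ x^S`. -/
noncomputable def constPower (x : C) (S : SSet.{v}) : x ⟶ power (F.functor.obj x) S :=
  powerLift (F.constMap x S)

lemma constPower_eval (x : C) {S : SSet.{v}} {n : SimplexCategoryᵒᵖ} (s : S.obj n) :
    F.constPower x S ≫ powerEval _ s = F.const x n :=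
  powerLift_eval _ s

lemma constPower_map (x : C) {S T : SSet.{v}} (i : S ⟶ T) :
    F.constPower x T ≫ powerMap _ i = F.constPower x S := by
  refine power_hom_ext fun n s => ?_
  rw [Category.assoc, powerMap_eval, constPower_eval, constPower_eval]

lemma powerEval_of_powerMap_eq_constPower {x y : C} {S T : SSet.{v}} {i : S ⟶ T}
    {f : x ⟶ power (F.functor.obj y) T} {g : x ⟶ y}
    (h : f ≫ powerMap (F.functor.obj y) i = g ≫ F.constPower y S)
    {n : SimplexCategoryᵒᵖ} (s : S.obj n) :
    f ≫ powerEval (F.functor.obj y) (i.app n s) = g ≫ F.const y n := by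
  rw [powerEval_of_powerMap_eq h, Category.assoc, constPower_eval]

lemma weakEquivalence_constPower_of_representableBy (y : C) [IsFibrant y] {S : SSet.{v}}
    {a : SimplexCategory} (h : S.RepresentableBy a) : WeakEquivalence (F.constPower y S) := by
  have := isIso_powerEval (F.functor.obj y) h
  have := F.weakEquivalence_unit y (op a)
  exact weakEquivalence_of_postcomp_of_fac (F.constPower_eval y (h.homEquiv (𝟙 a)))

/-- By two-out-of-three `y^B ⟶ y^{A ⊓ B}` is a trivial fibration, hence so is its base change `y^{A
⊔ B} ⟶ y^A`. No properness is needed. -/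
lemma weakEquivalence_constPower_sup (y : C) [IsFibrant y] {X : SSet.{v}} (A B : X.Subcomplex)
    (hA : WeakEquivalence (F.constPower y A)) (hB : WeakEquivalence (F.constPower y B))
    (hAB : WeakEquivalence (F.constPower y (A ⊓ B : X.Subcomplex))) :
    WeakEquivalence (F.constPower y (A ⊔ B : X.Subcomplex)) := by
  have sq : SSet.Subcomplex.BicartSq (A ⊓ B) A B (A ⊔ B) := ⟨rfl, rfl⟩
  have pb := powerMap_isPullback (F.functor.obj y) sq.isPushout
  have := F.fibration_powerMap y (SSet.Subcomplex.homOfLE sq.le₁₃)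
  have : WeakEquivalence (powerMap (F.functor.obj y) (SSet.Subcomplex.homOfLE sq.le₁₃)) :=
    weakEquivalence_of_precomp_of_fac (F.constPower_map y _)
  have ht : trivialFibrations C (powerMap (F.functor.obj y) (SSet.Subcomplex.homOfLE sq.le₂₄)) :=
    MorphismProperty.of_isPullback pb.flip (mem_trivialFibrations _)
  have : WeakEquivalence (powerMap (F.functor.obj y) (SSet.Subcomplex.homOfLE sq.le₂₄)) :=
    ((mem_trivialFibrations_iff _).1 ht).2
  exact weakEquivalence_of_postcomp_of_fac (F.constPower_map y (SSet.Subcomplex.homOfLE sq.le₂₄))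

lemma weakEquivalence_constPower_face (y : C) [IsFibrant y] {n : ℕ} (A : Finset (Fin (n + 1)))
    (hA : A.Nonempty) :
    WeakEquivalence (F.constPower y (SSet.stdSimplex.face.{v} A)) :=
  F.weakEquivalence_constPower_of_representableBy y
    -- A face with `A.card` vertices has dimension `A.card - 1`; nonemptiness keeps the subtraction
    -- from truncating.
    (SSet.stdSimplex.faceRepresentableBy A (A.card - 1)
      (A.orderIsoOfFin (by have := hA.card_pos; omega)))

/-- The map `y ⟶ y^S` is a weak equivalence if `S` is a nonempty finite union of faces of `Δ[n]`
with a common vertex. -/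
lemma weakEquivalence_constPower_iSup_face (y : C) [IsFibrant y] {n : ℕ} (k : Fin (n + 1))
    {ι : Type} (s : Finset ι) (hs : s.Nonempty) (A : ι → Finset (Fin (n + 1)))
    (hA : ∀ i ∈ s, k ∈ A i) :
    WeakEquivalence
      (F.constPower y (⨆ i ∈ s, SSet.stdSimplex.face.{v} (A i) : (Δ[n] : SSet.{v}).Subcomplex)) := by
  classical
  induction hs using Finset.Nonempty.cons_induction generalizing A with
  | singleton i =>
    rw [Finset.iSup_singleton]
    exact F.weakEquivalence_constPower_face y _ ⟨k, hA i (by simp)⟩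
  | cons i s hi hs ih =>
    have e : (⨆ j ∈ Finset.cons i s hi, SSet.stdSimplex.face.{v} (A j)) =
        SSet.stdSimplex.face (A i) ⊔ ⨆ j ∈ s, SSet.stdSimplex.face.{v} (A j) := by
      rw [Finset.cons_eq_insert, Finset.iSup_insert]
    rw [e]
    refine F.weakEquivalence_constPower_sup y _ _
      (F.weakEquivalence_constPower_face y _ ⟨k, hA i (by simp)⟩)
      (ih A fun j hj => hA j (by simp [hj])) ?_
    -- The intersection is again a union of faces indexed by `s`, so the induction hypothesis
    -- applies to the family `A i ⊓ A j`; the common vertex `k` keeps these faces nonempty.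
    have e' : SSet.stdSimplex.face (A i) ⊓ ⨆ j ∈ s, SSet.stdSimplex.face.{v} (A j) =
        ⨆ j ∈ s, SSet.stdSimplex.face (A i ⊓ A j) := by
      simp only [← SSet.stdSimplex.face_inter_face]
      ext m x
      simp
    rw [e']
    refine ih (fun j => A i ⊓ A j) fun j hj => ?_
    simp [hA i (by simp), hA j (by simp [hj])]

lemma weakEquivalence_constPower_horn (y : C) [IsFibrant y] (n : ℕ) (k : Fin (n + 2)) :
    WeakEquivalence (F.constPower y (SSet.horn.{v} (n + 1) k)) := by
  have e : SSet.horn.{v} (n + 1) k =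
      ⨆ j ∈ ({k}ᶜ : Finset (Fin (n + 2))), SSet.stdSimplex.face.{v} {j}ᶜ := by
    rw [SSet.horn_eq_iSup, iSup_subtype]
    simp
  rw [e]
  refine F.weakEquivalence_constPower_iSup_face y k _ ?_ _ fun j hj => ?_
  · rw [← Finset.card_pos, Finset.card_compl]
    simp
  · simpa [eq_comm] using hj

lemma weakEquivalence_powerMap_horn (y : C) [IsFibrant y] (n : ℕ) (k : Fin (n + 2)) :
    WeakEquivalence (powerMap (F.functor.obj y) (SSet.horn.{v} (n + 1) k).ι) := by
  have h₁ : WeakEquivalence (F.constPower y Δ[n + 1]) :=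
    F.weakEquivalence_constPower_of_representableBy y
      (a := ⦋n + 1⦌) { homEquiv := SSet.stdSimplex.objEquiv.symm, homEquiv_comp := fun _ _ => rfl }
  have h₂ := F.weakEquivalence_constPower_horn y n k
  exact weakEquivalence_of_precomp_of_fac (F.constPower_map y (SSet.horn.{v} (n + 1) k).ι)

/-! ### Horn filling and the Kan property -/

lemma exists_mapComplex_horn_filler (x y : C) [IsCofibrant x] [IsFibrant y] {n : ℕ}
    {k : Fin (n + 2)} (φ : (Λ[n + 1, k] : SSet.{v}) ⟶ F.mapComplex x y) :
    ∃ ψ : Δ[n + 1] ⟶ F.mapComplex x y, (SSet.horn.{v} (n + 1) k).ι ≫ ψ = φ := by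
  have := F.fibration_powerMap y (SSet.horn.{v} (n + 1) k).ι
  have := F.weakEquivalence_powerMap_horn y n k
  have sq : CommSq (initial.to _) (initial.to x)
      (powerMap (F.functor.obj y) (SSet.horn.{v} (n + 1) k).ι) (powerLift φ) :=
    ⟨initialIsInitial.hom_ext _ _⟩
  refine ⟨ofPower sq.lift, ?_⟩
  ext m s
  exact (powerEval_of_powerMap_eq sq.fac_right s).trans (powerLift_eval φ s)

/-- If a simplicial map from a standard simplex to `Map(x, y)` sends some simplex to a weak
equivalence, then it does so for all simplices. -/
lemma weakEquivalence_toHom_app_stdSimplex {x y : C} [IsFibrant y] {n : ℕ}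
    (ψ : Δ[n] ⟶ F.mapComplex x y) {m m' : SimplexCategoryᵒᵖ} (s : (Δ[n] : SSet.{v}).obj m)
    (s' : (Δ[n] : SSet.{v}).obj m') (hs : WeakEquivalence (F.toHom (ψ.app m s))) :
    WeakEquivalence (F.toHom (ψ.app m' s')) := by
  -- Every simplex of `Δ[n]` is the image of the top one under an operator, so all are compared with
  -- that one.
  have key (l : SimplexCategoryᵒᵖ) (t : (Δ[n] : SSet.{v}).obj l) :
      WeakEquivalence (F.toHom (ψ.app l t)) ↔
        WeakEquivalence (F.toHom (ψ.app _ (SSet.stdSimplex.objEquiv.symm (𝟙 ⦋n⦌)))) := by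
    rw [← F.weakEquivalence_toHom_map_iff (SSet.stdSimplex.objEquiv t).op,
      ← NatTrans.naturality_apply]
    have e : (Δ[n] : SSet.{v}).map (SSet.stdSimplex.objEquiv t).op
        (SSet.stdSimplex.objEquiv.symm (𝟙 ⦋n⦌)) = t := by
      rw [SSet.stdSimplex.map_objEquiv_symm, Quiver.Hom.unop_op, Category.comp_id,
        Equiv.symm_apply_apply]
    exact iff_of_eq (congrArg (fun t => WeakEquivalence (F.toHom (ψ.app l t))) e.symm)
  exact (key m' s').2 ((key m s).1 hs)

open scoped SSet.modelCategoryQuillen in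
lemma fibration_toUnit_weqComplex (x y : BifibrantObject C) :
    Fibration (CartesianMonoidalCategory.toUnit (F.weqComplex x y).toSSet) := by
  rw [SSet.modelCategoryQuillen.fibration_iff]
  intro A B i hi
  simp only [SSet.modelCategoryQuillen.J, MorphismProperty.iSup_iff] at hi
  obtain ⟨n, ⟨k⟩⟩ := hi
  refine ⟨fun {u b} sq => ?_⟩
  -- The horn is filled in the full complex `Map(x, y)`. The filler lands in the weak equivalences
  -- because its vertex `k` does: that vertex lies in the horn, on the face opposite any `j ≠ k`.
  obtain ⟨ψ, hψ⟩ := F.exists_mapComplex_horn_filler x.obj y.obj (u ≫ (F.weqComplex x y).ι)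
  obtain ⟨j, hj⟩ := exists_ne k
  have hk : SSet.stdSimplex.obj₀Equiv.symm k ∈ (SSet.horn.{v} (n + 1) k).obj (op ⦋0⦌) :=
    SSet.face_le_horn j k hj _
      ((SSet.stdSimplex.obj₀Equiv_symm_mem_face_iff _ _).2 (by simpa using hj.symm))
  have h₀ : WeakEquivalence (F.toHom (ψ.app _ (SSet.stdSimplex.obj₀Equiv.symm k))) := by
    have e := ConcreteCategory.congr_hom (NatTrans.congr_app hψ (op ⦋0⦌)) ⟨_, hk⟩
    refine (congrArg (fun t => WeakEquivalence (F.toHom t)) e).mpr ?_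
    exact (u.app (op ⦋0⦌) ⟨_, hk⟩).2
  have hr : SSet.Subcomplex.range ψ ≤ F.weqComplex x y := by
    rintro m _ ⟨s, rfl⟩
    exact F.weakEquivalence_toHom_app_stdSimplex ψ _ s h₀
  refine ⟨⟨{ l := SSet.Subcomplex.lift ψ hr, fac_left := ?_, fac_right := ?_ }⟩⟩
  · rw [← cancel_mono (F.weqComplex x y).ι, Category.assoc, SSet.Subcomplex.lift_ι, hψ]
  · exact CartesianMonoidalCategory.toUnit_unique _ _

/-! ### From left homotopies to edges, and inverses in `π₀` -/

lemma exists_edge_of_leftHomotopyRel {x y : C} [IsCofibrant x] [IsFibrant y] {f g : x ⟶ y}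
    (h : LeftHomotopyRel f g) :
    ∃ e : (F.mapComplex x y) _⦋1⦌,
      (F.mapComplex x y).δ 1 e = F.simplex (f ≫ F.const y (op ⦋0⦌)) ∧
      (F.mapComplex x y).δ 0 e = F.simplex (g ≫ F.const y (op ⦋0⦌)) := by
  obtain ⟨P, _, ⟨H⟩⟩ := h.exists_good_cylinder
  let Y := F.functor.obj y
  let A : (Δ[1] : SSet.{v}).Subcomplex := SSet.stdSimplex.face {0}
  let B : (Δ[1] : SSet.{v}).Subcomplex := SSet.stdSimplex.face {1}
  have hAB : A ⊓ B = ⊥ := by simp [A, B, SSet.stdSimplex.face_inter_face]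
  have bc : SSet.Subcomplex.BicartSq ⊥ A B (A ⊔ B) := ⟨rfl, hAB⟩
  have pb := powerMap_isPullback Y bc.isPushout
  have w : ((P.π ≫ f) ≫ F.constPower y A) ≫ powerMap Y (SSet.Subcomplex.homOfLE bc.le₁₂) =
      (H.h ≫ F.constPower y B) ≫ powerMap Y (SSet.Subcomplex.homOfLE bc.le₁₃) :=
    -- The empty complex has no simplices, so any two maps into its power agree.
    power_hom_ext fun _ s => s.2.elim
  have hfib := F.fibration_powerMap y (A ⊔ B).ι
  -- `P.i₀` is a trivial cofibration. Over `P`, the end `0` is prescribed as `P.π ≫ f` and the end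
  -- `1` as `H.h`; along `P.i₀` both are `f`, so the constant path starts the lift. Restricting the
  -- lift along `P.i₁` gives a path from `f` to `g`.
  have sq : CommSq (f ≫ F.constPower y Δ[1]) P.i₀ (powerMap Y (A ⊔ B).ι) (pb.lift _ _ w) := by
    refine ⟨pb.hom_ext ?_ ?_⟩
    · simp only [Category.assoc, pb.lift_fst, constPower_map, Y, Precylinder.i₀_π_assoc]
    · simp only [Category.assoc, pb.lift_snd, constPower_map, Y, H.h₀_assoc]
  let s : (Δ[1] : SSet.{v}).obj (op ⦋1⦌) := SSet.stdSimplex.objEquiv.symm (𝟙 ⦋1⦌)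
  have hA : sq.lift ≫ powerMap Y A.ι = (P.π ≫ f) ≫ F.constPower y A := by
    have e := sq.fac_right =≫ powerMap Y (SSet.Subcomplex.homOfLE bc.le₂₄)
    rw [pb.lift_fst, Category.assoc, powerMap_comp] at e
    exact e
  have hB : sq.lift ≫ powerMap Y B.ι = H.h ≫ F.constPower y B := by
    have e := sq.fac_right =≫ powerMap Y (SSet.Subcomplex.homOfLE bc.le₃₄)
    rw [pb.lift_snd, Category.assoc, powerMap_comp] at e
    exact e
  -- The face `δ 1` omits the vertex `1`, so it is the vertex `0`.
  have mA : (Δ[1] : SSet.{v}).map (SimplexCategory.δ 1).op s ∈ A.obj (op ⦋0⦌) := by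
    simp only [A, SSet.stdSimplex.mem_face_iff]
    intro i
    fin_cases i
    exact Finset.mem_singleton.2 rfl
  have mB : (Δ[1] : SSet.{v}).map (SimplexCategory.δ 0).op s ∈ B.obj (op ⦋0⦌) := by
    simp only [B, SSet.stdSimplex.mem_face_iff]
    intro i
    fin_cases i
    exact Finset.mem_singleton.2 rfl
  refine ⟨P.i₁ ≫ sq.lift ≫ powerEval Y s, ?_, ?_⟩
  · change (P.i₁ ≫ sq.lift ≫ powerEval Y s) ≫ Y.map (SimplexCategory.δ 1).op =
      f ≫ F.const y (op ⦋0⦌)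
    have e := F.powerEval_of_powerMap_eq_constPower hA ⟨_, mA⟩
    rw [Category.assoc, Category.assoc, powerEval_map]
    refine (congrArg (P.i₁ ≫ ·) e).trans ?_
    rw [Category.assoc, P.i₁_π_assoc]
  · change (P.i₁ ≫ sq.lift ≫ powerEval Y s) ≫ Y.map (SimplexCategory.δ 0).op =
      g ≫ F.const y (op ⦋0⦌)
    have e := F.powerEval_of_powerMap_eq_constPower hB ⟨_, mB⟩
    rw [Category.assoc, Category.assoc, powerEval_map]
    refine (congrArg (P.i₁ ≫ ·) e).trans ?_
    exact H.h₁_assoc _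

/-- The `0`-simplex of weak equivalences given by a weak equivalence of `C`. -/
def weqVertex {x y : BifibrantObject C} (f : x.obj ⟶ y.obj) (hf : WeakEquivalence f) :
    (F.weqComplex x y).toSSet _⦋0⦌ :=
  ⟨F.simplex (f ≫ F.const y.obj (op ⦋0⦌)), by
    have := F.weakEquivalence_unit y.obj (op ⦋0⦌)
    change WeakEquivalence (f ≫ F.const y.obj (op ⦋0⦌))
    infer_instance⟩

lemma weqVertex_surjective {x y : BifibrantObject C} (a : (F.weqComplex x y).toSSet _⦋0⦌) :
    ∃ (f : x.obj ⟶ y.obj) (hf : WeakEquivalence f), F.weqVertex f hf = a := by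
  have := F.isIso_unit_zero y.obj
  have : WeakEquivalence (F.toHom a.1) := a.2
  refine ⟨F.toHom a.1 ≫ inv (F.const y.obj (op ⦋0⦌)), inferInstance, Subtype.ext ?_⟩
  change (F.toHom a.1 ≫ inv (F.const y.obj (op ⦋0⦌))) ≫ F.const y.obj (op ⦋0⦌) = F.toHom a.1
  rw [Category.assoc, IsIso.inv_hom_id, Category.comp_id]

/-- The edge in `Map(x, y)` is itself a weak equivalence because one of its ends is, so it lies in
the subcomplex. -/
lemma π₀_mk_weqVertex_eq {x y : BifibrantObject C} {f g : x.obj ⟶ y.obj}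
    (hf : WeakEquivalence f) (hg : WeakEquivalence g) (h : LeftHomotopyRel f g) :
    SSet.π₀.mk (F.weqVertex f hf) = SSet.π₀.mk (F.weqVertex g hg) := by
  obtain ⟨e, h₁, h₀⟩ := F.exists_edge_of_leftHomotopyRel h
  have he : WeakEquivalence (F.toHom e) := by
    rw [← F.weakEquivalence_toHom_map_iff (SimplexCategory.δ 1).op]
    exact (congrArg (fun t => WeakEquivalence (F.toHom t)) h₁).mpr (F.weqVertex f hf).2
  exact SSet.π₀.sound (SSet.Edge.mk ⟨e, he⟩ (Subtype.ext h₁) (Subtype.ext h₀))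

end

variable {F : FunctorialSimplicialFraming C}

lemma WStar.id₀_eq {κ : F.Composition} (x : WStar κ) :
    SimpCat.id₀ x = F.weqVertex (𝟙 x.obj.obj) inferInstance :=
  Subtype.ext (Category.id_comp (F.const x.obj.obj (op ⦋0⦌))).symm

lemma WStar.compAt_weqVertex {κ : F.Composition} {x y z : WStar κ} (f : x.obj.obj ⟶ y.obj.obj)
    (g : y.obj.obj ⟶ z.obj.obj) (hf : WeakEquivalence f) (hg : WeakEquivalence g) :
    SimpCat.compAt (x := x) (y := y) (z := z) (F.weqVertex f hf) (F.weqVertex g hg) =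
      F.weqVertex (f ≫ g) inferInstance :=
  Subtype.ext (κ.comp_zero x.obj y.obj z.obj f g)

lemma WStar.isGroupoid_piZero (κ : F.Composition) : IsGroupoid (SimpCat.PiZero (WStar κ)) where
  all_isIso {x y} f := by
    obtain ⟨a, rfl⟩ := SSet.π₀.mk_surjective f
    obtain ⟨f, hf, rfl⟩ := F.weqVertex_surjective a
    obtain ⟨g, h₁, h₂⟩ := LeftHomotopyClass.whitehead f
    -- The homotopy inverse must be a weak equivalence to define a map of `W_*(C)`: `f ≫ g` is
    -- homotopic to an identity, and two-out-of-three gives `g`.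
    have hfg : WeakEquivalence (f ≫ g) := by
      obtain ⟨P, ⟨H⟩⟩ := h₁
      rw [H.weakEquivalence_iff]
      infer_instance
    have hg : WeakEquivalence g := weakEquivalence_of_precomp f g
    refine ⟨⟨SSet.π₀.mk (F.weqVertex g hg), ?_, ?_⟩⟩
    · refine (congrArg SSet.π₀.mk (WStar.compAt_weqVertex f g hf hg)).trans
        ((F.π₀_mk_weqVertex_eq _ inferInstance h₁).trans ?_)
      exact congrArg SSet.π₀.mk (WStar.id₀_eq x.obj).symm
    · refine (congrArg SSet.π₀.mk (WStar.compAt_weqVertex g f hg hf)).trans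
        ((F.π₀_mk_weqVertex_eq _ inferInstance h₂).trans ?_)
      exact congrArg SSet.π₀.mk (WStar.id₀_eq y.obj).symm

end FunctorialSimplicialFraming

namespace SimpCat

lemma isHomotopyEquivalence_id₀ {W : Type u} [EnrichedCategory SSet.{v} W] (x : W) :
    IsHomotopyEquivalence (id₀ x) :=
  inferInstanceAs (IsIso (𝟙 (PiZero.mk x)))

open scoped SSet.modelCategoryQuillen in
lemma isWeakFibration_toPoint {W : Type u} [EnrichedCategory SSet.{v} W]
    (h : ∀ x y : W, Fibration (CartesianMonoidalCategory.toUnit (x ⟶[SSet.{v}] y))) :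
    IsWeakFibration (toPoint W) :=
  -- The point has a single `0`-map, so the identity of `x` lifts it.
  ⟨h, fun x _ _ _ => ⟨x, id₀ x, isHomotopyEquivalence_id₀ x, rfl⟩⟩

end SimpCat

theorem lemma5p2 {C : Type u} [Category.{v} C] [ModelCategory C] [HasLimits C]
    (F : FunctorialSimplicialFraming C) (κ : F.Composition) :
    SimpCat.IsFibrantGroupoid.{u, v} (FunctorialSimplicialFraming.WStar κ) where
  fibrant := SimpCat.isWeakFibration_toPoint fun x y => F.fibration_toUnit_weqComplex x.obj y.obj
  isGroupoid := FunctorialSimplicialFraming.WStar.isGroupoid_piZero κ
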